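/- Let $\mathfrak g$ be a finite-dimensional real Lie algebra with a scalar product $(\,\cdot\,,\cdot\,)$ (a positive definite symmetric bilinear form). Let $(u,v)\mapsto uv$ be the bilinear product on $\mathfrak g$ determined by $$2(uv,w)=([u,v],w)+([w,u],v)+([w,v],u)\qquad\text{for all }u,v,w\in\mathfrak g;$$ equivalently, $uv-vu=[u,v]$ and $(uv,w)+(v,uw)=0$ for all $u,v,w$. The pair $(\mathfrak g,(\,\cdot\,,\cdot\,))$ is called a Riemann-Lie algebra if moreover $[uv,w]+[u,wv]=0$ for all $u,v,w\in\mathfrak g$. For an endomorphism $\varphi$ of $\mathfrak g$ let $\varphi^t$ be its adjoint, $(\varphi(v),w)=(v,\varphi^t(w))$, and let $S=\{s\in\mathfrak g : \mathrm{ad}_s+\mathrm{ad}_s^t=0\}$, which is a Lie subalgebra of $\mathfrak g$. Then the following are equivalent: 1. $(\mathfrak g,(\,\cdot\,,\cdot\,))$ is a Riemann-Lie algebra; 2. $S$ is abelian, and there is a commutative Lie ideal $U$ of $\mathfrak g$ such that $\mathfrak g=S\oplus U$ is an orthogonal direct sum. Moreover, if $(\mathfrak g,(\,\cdot\,,\cdot\,))$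 is a Riemann-Lie algebra, then $S=\{u\in\mathfrak g : vu=0\text{ for all }v\in\mathfrak g\}$ (this set is denoted $Z_r(\mathfrak g)$), and $S^\perp=\mathfrak g\mathfrak g=[\mathfrak g,\mathfrak g]$, where $\mathfrak g\mathfrak g$ is the linear span of all products $uv$ with $u,v\in\mathfrak g$. -/

import Mathlib

noncomputable section

namespace RiemannLie

variable {𝔤 : Type*} [LieRing 𝔤] [LieAlgebra ℝ 𝔤]

/-- A scalar product: a positive definite symmetric bilinear form. -/
structure IsScalarProduct (B : LinearMap.BilinForm ℝ 𝔤) : Prop where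
  symm : B.IsSymm
  pos : ∀ x : 𝔤, x ≠ 0 → 0 < B x x

theorem IsScalarProduct.nondegenerate {B : LinearMap.BilinForm ℝ 𝔤} (h : IsScalarProduct B) :
    B.Nondegenerate := by
  constructor
  · intro x hx
    by_contra hne
    exact (h.pos x hne).ne' (hx x)
  · intro x hx
    by_contra hne
    exact (h.pos x hne).ne' (hx x)

/-- For fixed `u` and `v`, the linear form `w ↦ ([u, v], w) + ([w, u], v) + ([w, v], u)`. -/
def koszulForm (B : LinearMap.BilinForm ℝ 𝔤) (u v : 𝔤) : Module.Dual ℝ 𝔤 where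
  toFun w := B ⁅u, v⁆ w + B ⁅w, u⁆ v + B ⁅w, v⁆ u
  map_add' x y := by
    simp only [map_add, add_lie, LinearMap.add_apply]
    ring
  map_smul' c x := by
    simp only [map_smul, smul_lie, LinearMap.smul_apply, smul_eq_mul, RingHom.id_apply]
    ring

variable [FiniteDimensional ℝ 𝔤]

/-- The product `u v = A_u v` on `𝔤`: the unique bilinear map with
`2 (A_u v, w) = ([u, v], w) + ([w, u], v) + ([w, v], u)`; see `two_mul_product` and
`eq_product`. -/
def product (B : LinearMap.BilinForm ℝ 𝔤) (hB : B.Nondegenerate) : 𝔤 →ₗ[ℝ] 𝔤 →ₗ[ℝ] 𝔤 :=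
  LinearMap.mk₂ ℝ (fun u v => (B.toDual hB).symm ((2⁻¹ : ℝ) • koszulForm B u v))
    (fun u₁ u₂ v => by
      rw [← map_add, ← smul_add]
      congr 2
      ext w
      simp only [koszulForm, LinearMap.coe_mk, AddHom.coe_mk, LinearMap.add_apply, add_lie, lie_add,
        map_add]
      ring)
    (fun c u v => by
      rw [← map_smul, smul_comm]
      congr 2
      ext w
      simp only [koszulForm, LinearMap.coe_mk, AddHom.coe_mk, LinearMap.smul_apply, smul_lie,
        lie_smul, map_smul, smul_eq_mul]
      ring)
    (fun u v₁ v₂ => by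
      rw [← map_add, ← smul_add]
      congr 2
      ext w
      simp only [koszulForm, LinearMap.coe_mk, AddHom.coe_mk, LinearMap.add_apply, lie_add,
        map_add]
      ring)
    (fun c u v => by
      rw [← map_smul, smul_comm]
      congr 2
      ext w
      simp only [koszulForm, LinearMap.coe_mk, AddHom.coe_mk, LinearMap.smul_apply,
        lie_smul, map_smul, smul_eq_mul]
      ring)

theorem two_mul_product (B : LinearMap.BilinForm ℝ 𝔤) (hB : B.Nondegenerate) (u v w : 𝔤) :
    2 * B (product B hB u v) w = B ⁅u, v⁆ w + B ⁅w, u⁆ v + B ⁅w, v⁆ u := by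
  simp only [product, LinearMap.mk₂_apply, LinearMap.BilinForm.apply_toDual_symm_apply,
    LinearMap.smul_apply, smul_eq_mul, koszulForm, LinearMap.coe_mk, AddHom.coe_mk]
  ring

theorem eq_product (B : LinearMap.BilinForm ℝ 𝔤) (hB : B.Nondegenerate) {u v a : 𝔤}
    (h : ∀ w, 2 * B a w = B ⁅u, v⁆ w + B ⁅w, u⁆ v + B ⁅w, v⁆ u) : a = product B hB u v := by
  rw [← sub_eq_zero]
  refine hB.1 _ fun w => ?_
  rw [map_sub, LinearMap.sub_apply]
  linarith [h w, two_mul_product B hB u v w]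

/-- A pseudo-Riemannian Lie algebra: a Lie algebra with a non-degenerate symmetric bilinear form
whose product `u v = A_u v` satisfies (PR1)-(PR3). -/
structure IsPseudoRiemannianLie (𝔤 : Type*) [LieRing 𝔤] [LieAlgebra ℝ 𝔤] [FiniteDimensional ℝ 𝔤]
    (B : LinearMap.BilinForm ℝ 𝔤) : Prop where
  symm : B.IsSymm
  nondeg : B.Nondegenerate
  pr1 : ∀ u v : 𝔤, product B nondeg u v - product B nondeg v u = ⁅u, v⁆
  pr2 : ∀ u v w : 𝔤, B (product B nondeg u v) w + B v (product B nondeg u w) = 0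
  pr3 : ∀ u v w : 𝔤, ⁅product B nondeg u v, w⁆ + ⁅u, product B nondeg w v⁆ = 0

/-- A Riemann-Lie algebra: a pseudo-Riemannian Lie algebra whose form is positive definite. -/
structure IsRiemannLie (𝔤 : Type*) [LieRing 𝔤] [LieAlgebra ℝ 𝔤] [FiniteDimensional ℝ 𝔤]
    (B : LinearMap.BilinForm ℝ 𝔤) : Prop extends IsPseudoRiemannianLie 𝔤 B where
  pos : ∀ x : 𝔤, x ≠ 0 → 0 < B x x

/-- The right multiplication `r_u : v ↦ v u`. -/
def rightMul (B : LinearMap.BilinForm ℝ 𝔤) (hB : B.Nondegenerate) (u : 𝔤) : Module.End ℝ 𝔤 :=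
  (product B hB).flip u

/-- `Z_r(𝔤) = {u | r_u = 0}`. -/
def Zr (B : LinearMap.BilinForm ℝ 𝔤) (hB : B.Nondegenerate) : Submodule ℝ 𝔤 where
  carrier := {u | rightMul B hB u = 0}
  zero_mem' := by simp [rightMul]
  add_mem' {u v} hu hv := by
    simp only [rightMul, Set.mem_setOf_eq] at *
    rw [map_add, hu, hv, add_zero]
  smul_mem' c u hu := by
    simp only [rightMul, Set.mem_setOf_eq] at *
    rw [map_smul, hu, smul_zero]

/-- `𝔤𝔤`, the linear span of all products `x y`. -/
def productSpan (B : LinearMap.BilinForm ℝ 𝔤) (hB : B.Nondegenerate) : Submodule ℝ 𝔤 :=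
  Submodule.span ℝ {z | ∃ x y : 𝔤, z = product B hB x y}

/-- The adjoint `φ^t` of an endomorphism `φ`; see `apply_transpose`. -/
def transpose (B : LinearMap.BilinForm ℝ 𝔤) (hB : B.Nondegenerate) (φ : Module.End ℝ 𝔤) :
    Module.End ℝ 𝔤 :=
  B.leftAdjointOfNondegenerate hB φ

theorem apply_transpose {B : LinearMap.BilinForm ℝ 𝔤} (hB : IsScalarProduct B)
    (φ : Module.End ℝ 𝔤) (v w : 𝔤) :
    B (φ v) w = B v (transpose B hB.nondegenerate φ w) := by
  rw [hB.symm.eq v, hB.symm.eq (φ v)]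
  exact (B.isAdjointPairLeftAdjointOfNondegenerate hB.nondegenerate φ w v).symm

theorem ad_add_transpose_eq_zero_iff {B : LinearMap.BilinForm ℝ 𝔤} (hB : IsScalarProduct B)
    (s : 𝔤) :
    LieAlgebra.ad ℝ 𝔤 s + transpose B hB.nondegenerate (LieAlgebra.ad ℝ 𝔤 s) = 0 ↔
      ∀ v w : 𝔤, B ⁅s, v⁆ w + B v ⁅s, w⁆ = 0 := by
  have key : ∀ v w : 𝔤, B v ((LieAlgebra.ad ℝ 𝔤 s +
      transpose B hB.nondegenerate (LieAlgebra.ad ℝ 𝔤 s)) w) = B ⁅s, v⁆ w + B v ⁅s, w⁆ := by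
    intro v w
    rw [LinearMap.add_apply, map_add, ← apply_transpose hB, LieAlgebra.ad_apply,
      LieAlgebra.ad_apply, add_comm]
  constructor
  · intro h v w
    rw [← key, h, LinearMap.zero_apply, map_zero]
  · intro h
    ext w
    exact hB.nondegenerate.2 _ fun v => by rw [key, h]

/-- The orthogonal Lie subalgebra `S = {s | ad_s + ad_s^t = 0}`. -/
def orthogonalSubalgebra (B : LinearMap.BilinForm ℝ 𝔤) (hB : IsScalarProduct B) :
    LieSubalgebra ℝ 𝔤 where
  carrier := {s | LieAlgebra.ad ℝ 𝔤 s +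
    transpose B hB.nondegenerate (LieAlgebra.ad ℝ 𝔤 s) = 0}
  zero_mem' := by simp [ad_add_transpose_eq_zero_iff hB]
  add_mem' {s t} hs ht := by
    simp only [Set.mem_setOf_eq, ad_add_transpose_eq_zero_iff hB] at *
    intro v w
    simp only [add_lie, map_add, LinearMap.add_apply]
    linarith [hs v w, ht v w]
  smul_mem' c s hs := by
    simp only [Set.mem_setOf_eq, ad_add_transpose_eq_zero_iff hB] at *
    intro v w
    simp only [smul_lie, map_smul, LinearMap.smul_apply, smul_eq_mul]
    rw [← mul_add, hs v w, mul_zero]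
  lie_mem' {s t} hs ht := by
    change _ = _ at hs
    change _ = _ at ht
    change _ = _
    rw [ad_add_transpose_eq_zero_iff hB] at *
    intro v w
    simp only [lie_lie, map_sub, LinearMap.sub_apply]
    linarith [hs ⁅t, v⁆ w, ht ⁅s, v⁆ w, hs v ⁅t, w⁆, ht v ⁅s, w⁆]

end RiemannLie

end

/-! Write `L a`, `R a` for left and right multiplication; `L a` is always skew. The core is that
(xy)z = 0 in a Riemann-Lie algebra (`product_product_eq_zero`). Its first half is (R v)² = 0
(`product_product_self`): this square is self-adjoint and has no nonzero eigenvalue. So (xy)z is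
antisymmetric in y, z. A trace form argument gives `L ⁅a, b⁆ = 0`, so (xy)z is also symmetric in x,
y, hence zero. For s in S, `R s` is skew with square zero, so S = Z_r = (𝔤𝔤)^⊥, and U = 𝔤𝔤 is
abelian. Conversely, the decomposition forces (s + u)(t + v) = [s, v], and the Riemann-Lie identity
becomes the Jacobi identity. -/

namespace RiemannLie

/-! ### Linear algebra of a positive definite form -/

section BilinForm

variable {V : Type*} [AddCommGroup V] [Module ℝ V]
  {B : LinearMap.BilinForm ℝ V}

theorem trace_eq_sum {ι : Type*} [Fintype ι] [DecidableEq ι] {b : Module.Basis ι ℝ V}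
    (hb : ∀ (x : V) (i), b.repr x i = B x (b i)) (T : Module.End ℝ V) :
    LinearMap.trace ℝ V T = ∑ i, B (T (b i)) (b i) := by
  simp [LinearMap.trace_eq_matrix_trace ℝ b, Matrix.trace, LinearMap.toMatrix_apply, hb]

theorem eq_zero_of_skew_of_sq (hp : ∀ x, x ≠ 0 → 0 < B x x)
    (T : Module.End ℝ V) (hT : ∀ x y, B (T x) y + B x (T y) = 0)
    (hsq : ∀ x, T (T x) = 0) (x : V) : T x = 0 := by
  by_contra h
  have := hT x (T x)
  rw [hsq, map_zero, add_zero] at this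
  exact (hp _ h).ne' this

/-- The inner product space core given by a scalar product. -/
@[reducible]
def innerProductCore (hs : ∀ x y, B x y = B y x) (hp : ∀ x, x ≠ 0 → 0 < B x x) :
    InnerProductSpace.Core ℝ V where
  inner := fun x y => B x y
  conj_inner_symm := fun x y => by simpa using hs y x
  re_inner_nonneg := fun x => by
    rcases eq_or_ne x 0 with rfl | h
    · simp
    · simpa using (hp x h).le
  add_left := fun x y z => by simp
  smul_left := fun x y r => by simp
  definite := fun x hx => by
    by_contra h
    exact (hp x h).ne' hx

variable [FiniteDimensional ℝ V]

/-- A scalar product on a finite-dimensional real vector space has an orthonormal basis. -/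
theorem exists_basis_orthonormal (hs : ∀ x y, B x y = B y x) (hp : ∀ x, x ≠ 0 → 0 < B x x) :
    ∃ b : Module.Basis (Fin (Module.finrank ℝ V)) ℝ V,
      ∀ (x : V) (i), b.repr x i = B x (b i) := by
  let core := innerProductCore hs hp
  let _ : NormedAddCommGroup V := core.toNormedAddCommGroup
  let _ : InnerProductSpace ℝ V := InnerProductSpace.ofCore core.toCore
  refine ⟨(stdOrthonormalBasis ℝ V).toBasis, fun x i => ?_⟩
  rw [OrthonormalBasis.coe_toBasis_repr_apply, OrthonormalBasis.repr_apply_apply,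
    OrthonormalBasis.coe_toBasis, real_inner_comm]
  rfl

/-- A self-adjoint endomorphism without nonzero eigenvalues is zero. -/
theorem eq_zero_of_selfAdjoint_of_eigenvalue (hs : ∀ x y, B x y = B y x)
    (hp : ∀ x, x ≠ 0 → 0 < B x x) (T : Module.End ℝ V) (hT : ∀ x y, B (T x) y = B x (T y))
    (he : ∀ (c : ℝ) (x : V), c ≠ 0 → T x = c • x → x = 0) : T = 0 := by
  let core := innerProductCore hs hp
  let _ : NormedAddCommGroup V := core.toNormedAddCommGroup
  let _ : InnerProductSpace ℝ V := InnerProductSpace.ofCore core.toCore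
  have hsym : T.IsSymmetric := hT
  refine (hsym.eigenvectorBasis rfl).toBasis.ext fun i => ?_
  have h := hsym.apply_eigenvectorBasis rfl i
  rw [OrthonormalBasis.coe_toBasis, LinearMap.zero_apply, h]
  by_cases hc : hsym.eigenvalues rfl i = 0
  · simp [hc]
  · rw [he _ _ hc h, smul_zero]

theorem trace_eq_zero_of_skew (hs : ∀ x y, B x y = B y x) (hp : ∀ x, x ≠ 0 → 0 < B x x)
    (T : Module.End ℝ V) (hT : ∀ x y, B (T x) y + B x (T y) = 0) :
    LinearMap.trace ℝ V T = 0 := by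
  obtain ⟨b, hb⟩ := exists_basis_orthonormal hs hp
  rw [trace_eq_sum hb]
  exact Finset.sum_eq_zero fun i _ => by linarith [hT (b i) (b i), hs (b i) (T (b i))]

/-- In an orthonormal basis, tr T² = -∑ |T bᵢ|². -/
theorem eq_zero_of_skew_of_trace_mul_self (hs : ∀ x y, B x y = B y x)
    (hp : ∀ x, x ≠ 0 → 0 < B x x) (T : Module.End ℝ V)
    (hT : ∀ x y, B (T x) y + B x (T y) = 0) (htr : LinearMap.trace ℝ V (T * T) = 0) :
    T = 0 := by
  obtain ⟨b, hb⟩ := exists_basis_orthonormal hs hp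
  have hnn : ∀ x, 0 ≤ B x x := fun x => by
    rcases eq_or_ne x 0 with rfl | h
    · simp
    · exact (hp x h).le
  have hsum : ∑ i, B (T (b i)) (T (b i)) = 0 := by
    rw [← neg_eq_zero, ← htr, trace_eq_sum hb, ← Finset.sum_neg_distrib]
    exact Finset.sum_congr rfl fun i _ => by
      rw [Module.End.mul_apply]
      linarith [hT (T (b i)) (b i)]
  rw [Finset.sum_eq_zero_iff_of_nonneg fun i _ => hnn _] at hsum
  refine b.ext fun i => ?_
  by_contra h
  exact (hp _ h).ne' (hsum i (Finset.mem_univ i))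

theorem orthogonal_orthogonal_of_pos (hs : ∀ x y, B x y = B y x)
    (hp : ∀ x, x ≠ 0 → 0 < B x x) (W : Submodule ℝ V) : B.orthogonal (B.orthogonal W) = W := by
  refine LinearMap.BilinForm.orthogonal_orthogonal ?_ ?_ W
  · constructor
    all_goals
      intro x hx
      by_contra h
      exact (hp x h).ne' (hx x)
  · intro x y h
    rw [hs, h]

theorem isCompl_orthogonal_of_pos (hs : ∀ x y, B x y = B y x)
    (hp : ∀ x, x ≠ 0 → 0 < B x x) (W : Submodule ℝ V) : IsCompl W (B.orthogonal W) := by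
  refine (LinearMap.BilinForm.isCompl_orthogonal_iff_disjoint
    (fun x y h => by rw [hs, h])).2 ?_
  rw [Submodule.disjoint_def]
  intro x hx hx'
  by_contra h
  exact (hp x h).ne' (hx' x hx)

/-- For self-adjoint T, (range T)^⊥ ⊆ ker T; take orthogonals. -/
theorem mem_range_of_orthogonal_ker (hs : ∀ x y, B x y = B y x)
    (hp : ∀ x, x ≠ 0 → 0 < B x x) (T : Module.End ℝ V) (hT : ∀ x y, B (T x) y = B x (T y))
    (v : V) (hv : ∀ x, T x = 0 → B x v = 0) : ∃ y, T y = v := by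
  change v ∈ LinearMap.range T
  rw [← orthogonal_orthogonal_of_pos hs hp (LinearMap.range T)]
  intro x hx
  refine hv x ?_
  by_contra h
  exact (hp _ h).ne' ((hT x (T x)).trans
    ((hs _ _).trans (hx _ ⟨T x, rfl⟩)))

end BilinForm

/-! ### General properties of the product -/

section Product

variable {𝔤 : Type*} [LieRing 𝔤] [LieAlgebra ℝ 𝔤] [FiniteDimensional ℝ 𝔤]
  {B : LinearMap.BilinForm ℝ 𝔤}

theorem product_sub_product_swap (hB : B.Nondegenerate) (u v : 𝔤) :
    product B hB u v - product B hB v u = ⁅u, v⁆ := by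
  rw [← sub_eq_zero]
  refine hB.1 _ fun w => ?_
  have h : B ⁅v, u⁆ w = -B ⁅u, v⁆ w := by rw [← lie_skew v u, map_neg, LinearMap.neg_apply]
  simp only [map_sub, LinearMap.sub_apply]
  linarith [two_mul_product B hB u v w, two_mul_product B hB v u w]

theorem product_skew (hs : B.IsSymm) (hB : B.Nondegenerate) (u v w : 𝔤) :
    B (product B hB u v) w + B v (product B hB u w) = 0 := by
  have h1 : B ⁅w, v⁆ u = -B ⁅v, w⁆ u := by rw [← lie_skew w v, map_neg, LinearMap.neg_apply]
  have h2 : B ⁅w, u⁆ v = -B ⁅u, w⁆ v := by rw [← lie_skew w u, map_neg, LinearMap.neg_apply]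
  have h3 : B ⁅v, u⁆ w = -B ⁅u, v⁆ w := by rw [← lie_skew v u, map_neg, LinearMap.neg_apply]
  have h4 : B v (product B hB u w) = B (product B hB u w) v := hs.eq _ _
  linarith [two_mul_product B hB u v w, two_mul_product B hB u w v]

theorem mem_Zr_iff (hB : B.Nondegenerate) (u : 𝔤) :
    u ∈ Zr B hB ↔ ∀ v, product B hB v u = 0 := by
  change rightMul B hB u = 0 ↔ _
  exact LinearMap.ext_iff

theorem mem_orthogonalSubalgebra_iff (hB : IsScalarProduct B) (s : 𝔤) :
    s ∈ orthogonalSubalgebra B hB ↔ ∀ v w : 𝔤, B ⁅s, v⁆ w + B v ⁅s, w⁆ = 0 :=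
  ad_add_transpose_eq_zero_iff hB s

theorem orthogonal_productSpan (hs : B.IsSymm) (hB : B.Nondegenerate) :
    B.orthogonal (productSpan B hB) = Zr B hB := by
  ext z
  rw [mem_Zr_iff]
  constructor
  · intro h v
    refine hB.2 _ fun w => ?_
    have h' : B (product B hB v w) z = 0 := h _ (Submodule.subset_span ⟨v, w, rfl⟩)
    linarith [product_skew hs hB v w z]
  · intro h p hp
    change B p z = 0
    induction hp using Submodule.span_induction with
    | mem p hp =>
      obtain ⟨x, y, rfl⟩ := hp
      have := product_skew hs hB x y z
      rwa [h, map_zero, add_zero] at this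
    | zero => simp
    | add p q _ _ h1 h2 => rw [map_add, LinearMap.add_apply, h1, h2, add_zero]
    | smul c p _ h1 => rw [map_smul, LinearMap.smul_apply, h1, smul_zero]

end Product

/-! ### From the decomposition to a Riemann-Lie algebra -/

section OfDecomposition

variable {𝔤 : Type*} [LieRing 𝔤] [LieAlgebra ℝ 𝔤] [FiniteDimensional ℝ 𝔤]
  {B : LinearMap.BilinForm ℝ 𝔤}

/-- If `𝔤 = S ⊕ U` orthogonally with `S` and `U` abelian, `U` an ideal, then
`(s + u) (t + v) = [s, v]`. -/
theorem product_of_decomposition (hB : IsScalarProduct B)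
    (hS : ∀ s ∈ orthogonalSubalgebra B hB, ∀ t ∈ orthogonalSubalgebra B hB, ⁅s, t⁆ = 0)
    (U : LieIdeal ℝ 𝔤) (hU : ∀ u ∈ U, ∀ v ∈ U, ⁅u, v⁆ = 0)
    (hSU : ∀ s ∈ orthogonalSubalgebra B hB, ∀ u ∈ U, B s u = 0)
    (hsup : ∀ x : 𝔤, ∃ s ∈ orthogonalSubalgebra B hB, ∃ u ∈ U, s + u = x)
    {s u t v : 𝔤} (hs : s ∈ orthogonalSubalgebra B hB) (hu : u ∈ U)
    (ht : t ∈ orthogonalSubalgebra B hB) (hv : v ∈ U) :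
    product B hB.nondegenerate (s + u) (t + v) = ⁅s, v⁆ := by
  symm
  apply eq_product
  intro w
  obtain ⟨r, hr, x, hx, rfl⟩ := hsup w
  have hs' := (mem_orthogonalSubalgebra_iff hB s).1 hs
  have ht' := (mem_orthogonalSubalgebra_iff hB t).1 ht
  have hr' := (mem_orthogonalSubalgebra_iff hB r).1 hr
  have e1 : ⁅u, t⁆ = -⁅t, u⁆ := (lie_skew _ _).symm
  have e2 : ⁅x, s⁆ = -⁅s, x⁆ := (lie_skew _ _).symm
  have e3 : ⁅x, t⁆ = -⁅t, x⁆ := (lie_skew _ _).symm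
  have z : ∀ a ∈ orthogonalSubalgebra B hB, ∀ b ∈ orthogonalSubalgebra B hB, ∀ c ∈ U,
      B ⁅a, c⁆ b = 0 := fun a _ b hb c hc => by
    rw [← hB.symm.eq]
    exact hSU b hb _ (lie_mem_right ℝ 𝔤 U a c hc)
  simp only [add_lie, lie_add, hS s hs t ht, hS r hr s hs, hS r hr t ht, hU u hu v hv,
    hU x hx u hu, hU x hx v hv, e1, e2, e3, map_add, map_neg, map_zero, LinearMap.add_apply,
    LinearMap.neg_apply, LinearMap.zero_apply, z s hs r hr v hv, z t ht r hr u hu,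
    z r hr t ht u hu, z s hs t ht x hx, z r hr s hs v hv, z t ht s hs x hx]
  -- Only pairings within U survive: skewness of ad_t and ad_r cancels their terms, and that of ad_s
  -- doubles ([s, v], x).
  have h1 := hs' v x
  have h2 := ht' u x
  have h3 := hr' u v
  rw [hB.symm.eq v ⁅s, x⁆] at h1
  rw [hB.symm.eq u ⁅t, x⁆] at h2
  rw [hB.symm.eq u ⁅r, v⁆] at h3
  linarith

theorem isRiemannLie_of_decomposition (hB : IsScalarProduct B)
    (hS : ∀ s ∈ orthogonalSubalgebra B hB, ∀ t ∈ orthogonalSubalgebra B hB, ⁅s, t⁆ = 0)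
    (U : LieIdeal ℝ 𝔤) (hU : ∀ u ∈ U, ∀ v ∈ U, ⁅u, v⁆ = 0)
    (hSU : ∀ s ∈ orthogonalSubalgebra B hB, ∀ u ∈ U, B s u = 0)
    (hsup : ∀ x : 𝔤, ∃ s ∈ orthogonalSubalgebra B hB, ∃ u ∈ U, s + u = x) :
    IsRiemannLie 𝔤 B where
  symm := hB.symm
  nondeg := hB.nondegenerate
  pr1 := product_sub_product_swap hB.nondegenerate
  pr2 := product_skew hB.symm hB.nondegenerate
  pr3 u v w := by
    obtain ⟨s, hs, u, hu, rfl⟩ := hsup u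
    obtain ⟨t, ht, v, hv, rfl⟩ := hsup v
    obtain ⟨r, hr, w, hw, rfl⟩ := hsup w
    rw [product_of_decomposition hB hS U hU hSU hsup hs hu ht hv,
      product_of_decomposition hB hS U hU hSU hsup hr hw ht hv, lie_add, add_lie,
      hU _ (lie_mem_right ℝ 𝔤 U s v hv) w hw, hU u hu _ (lie_mem_right ℝ 𝔤 U r v hv),
      ← lie_skew, leibniz_lie s r v, hS s hs r hr, zero_lie]
    abel
  pos := hB.pos

end OfDecomposition

/-! ### Vanishing of (xy)z -/

section Structure

variable {𝔤 : Type*} [LieRing 𝔤] [LieAlgebra ℝ 𝔤] [FiniteDimensional ℝ 𝔤]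
  {B : LinearMap.BilinForm ℝ 𝔤} {hB : B.Nondegenerate}

theorem lie_product_swap
    (h3 : ∀ u v w : 𝔤, ⁅product B hB u v, w⁆ + ⁅u, product B hB w v⁆ = 0) (u v w : 𝔤) :
    ⁅product B hB u v, w⁆ = ⁅product B hB w v, u⁆ := by
  rw [eq_neg_of_add_eq_zero_left (h3 u v w), lie_skew]

/-- Pair [uv, w] = [wv, u] with v and move left factors across by skewness; the terms (uv, wv)
cancel. -/
theorem rightMul_sq_selfAdjoint (hs : B.IsSymm)
    (h3 : ∀ u v w : 𝔤, ⁅product B hB u v, w⁆ + ⁅u, product B hB w v⁆ = 0) (u v w : 𝔤) :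
    B (product B hB (product B hB u v) v) w = B u (product B hB (product B hB w v) v) := by
  have h := lie_product_swap h3 u v w
  rw [← product_sub_product_swap hB, ← product_sub_product_swap hB] at h
  have h' := congrArg (fun x => B x v) h
  simp only [map_sub, LinearMap.sub_apply] at h'
  have sk := product_skew hs hB
  have sy : ∀ x y, B x y = B y x := hs.eq
  linarith [sk (product B hB u v) w v, sk w (product B hB u v) v,
    sk (product B hB w v) u v, sk u (product B hB w v) v, sy (product B hB u v) (product B hB w v),
    sy w (product B hB (product B hB u v) v)]

/-- In a Riemann-Lie algebra right multiplications have square zero. -/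
theorem product_product_self (hs : B.IsSymm) (hp : ∀ x : 𝔤, x ≠ 0 → 0 < B x x)
    (h3 : ∀ u v w : 𝔤, ⁅product B hB u v, w⁆ + ⁅u, product B hB w v⁆ = 0) (u v : 𝔤) :
    product B hB (product B hB u v) v = 0 := by
  have sy : ∀ x y, B x y = B y x := hs.eq
  have sk := product_skew hs hB
  have sw := lie_product_swap h3
  have p1 := product_sub_product_swap hB
  let R : Module.End ℝ 𝔤 := rightMul B hB v
  have hR : ∀ x, R x = product B hB x v := fun _ => rfl
  have hRv : ∀ x, B (R x) v = 0 := fun x => by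
    have h := sk x v v
    rw [sy v, ← hR] at h
    linarith
  have hRsa : ∀ x y, B (R (R x)) y = B x (R (R y)) := fun x y =>
    rightMul_sq_selfAdjoint hs h3 x v y
  have hRlie : ∀ x y, ⁅R x, y⁆ = -⁅x, R y⁆ := fun x y => eq_neg_of_add_eq_zero_left (h3 x v y)
  have key : R * R = 0 := by
    refine eq_zero_of_selfAdjoint_of_eigenvalue sy hp _ hRsa fun c x hc hx => ?_
    -- The range of R is orthogonal to v, so v is orthogonal to the c-eigenspace of R² and v = R²y -
    -- cy for some y. Moving R² across the bracket gives [x, v] = [R²x - cx, y] = 0.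
    have hcomm : ∀ x, R (R x) = c • x → ⁅x, v⁆ = 0 := by
      intro x hx
      obtain ⟨y, hy⟩ := mem_range_of_orthogonal_ker sy hp (R * R - c • 1)
        (fun x y => by
          simp only [LinearMap.sub_apply, Module.End.mul_apply, LinearMap.smul_apply,
            Module.End.one_apply, map_sub, map_smul, hRsa])
        v (fun x hx => by
          have hx' : R (R x) = c • x := sub_eq_zero.1 hx
          have := hRv (R x)
          rw [hx', map_smul, LinearMap.smul_apply, smul_eq_mul] at this
          exact (mul_eq_zero.1 this).resolve_left hc)
      have hy' : R (R y) - c • y = v := hy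
      rw [← hy', lie_sub, lie_smul, ← smul_lie, ← hx, hRlie, hRlie, neg_neg, sub_self]
    have hx : R (R x) = c • x := hx
    have c1 : ⁅x, v⁆ = 0 := hcomm x hx
    have c2 : ⁅R x, v⁆ = 0 := hcomm (R x) (by rw [hx, map_smul])
    by_contra hne
    have hRx : R x ≠ 0 := fun h => by
      rw [h, map_zero] at hx
      exact (smul_ne_zero hc hne) hx.symm
    -- `v x = x v`, hence `[x v, x] = -[v, x x]`
    have hvx : product B hB v x = R x := by
      have := p1 x v
      rw [c1, sub_eq_zero] at this
      exact this.symm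
    have d1 : ⁅R x, x⁆ = -⁅v, product B hB x x⁆ := by
      have := h3 v x x
      rw [hvx] at this
      exact eq_neg_of_add_eq_zero_left this
    have d2 : ⁅product B hB v v, x⁆ = 0 := by
      rw [sw v v x]
      exact c2
    -- `(a a, y) = ([y, a], a)`
    have sq : ∀ a y : 𝔤, B (product B hB a a) y = B ⁅y, a⁆ a := fun a y => by
      have := two_mul_product B hB a a y
      rw [lie_self, map_zero, LinearMap.zero_apply] at this
      linarith
    -- Altogether 2|xv|² = ([xv, x], v) = (vv, xx) = ([vv, x], x) = 0, contradicting xv ≠ 0.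
    have e1 := sq x (product B hB v v)
    rw [d2, map_zero, LinearMap.zero_apply] at e1
    have e2 := sq v (product B hB x x)
    rw [← lie_skew, ← d1] at e2
    have e3 := two_mul_product B hB x v (R x)
    rw [c1, c2] at e3
    simp only [map_zero, LinearMap.zero_apply, zero_add, add_zero] at e3
    have := hp _ hRx
    rw [← hR] at e3
    linarith [sy (product B hB v v) (product B hB x x)]
  exact LinearMap.congr_fun key u

/-- In a Riemann-Lie algebra `(x y) z = 0`. -/
theorem product_product_eq_zero (hs : B.IsSymm) (hp : ∀ x : 𝔤, x ≠ 0 → 0 < B x x)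
    (h3 : ∀ u v w : 𝔤, ⁅product B hB u v, w⁆ + ⁅u, product B hB w v⁆ = 0) (u v w : 𝔤) :
    product B hB (product B hB u v) w = 0 := by
  have sy : ∀ x y, B x y = B y x := hs.eq
  have p1 := product_sub_product_swap hB
  have sw := lie_product_swap h3
  have hsq := product_product_self hs hp h3
  -- Polarization of (uv)v = 0.
  have hanti : ∀ u v w, product B hB (product B hB u v) w
      = -product B hB (product B hB u w) v := by
    intro u v w
    have h := hsq u (v + w)
    simp only [map_add, LinearMap.add_apply, hsq, zero_add, add_zero] at h
    exact eq_neg_of_add_eq_zero_right h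
  let L : 𝔤 → Module.End ℝ 𝔤 := fun x => product B hB x
  let R : 𝔤 → Module.End ℝ 𝔤 := fun x => rightMul B hB x
  let tr := LinearMap.trace ℝ 𝔤
  have hL : ∀ x y, L x y = product B hB x y := fun _ _ => rfl
  have hLsk : ∀ a x y, B (L a x) y + B x (L a y) = 0 := product_skew hs hB
  have had : ∀ a, LieAlgebra.ad ℝ 𝔤 a = L a - R a := fun a => by
    ext x
    exact (p1 a x).symm
  -- the connection is flat
  have hflat : ∀ a b, L ⁅a, b⁆ = L a * L b - L b * L a := fun a b => by
    ext x
    have h := sw b x a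
    rw [← p1, ← p1, hanti b x a, hanti a x b] at h
    have h' := congrArg (fun y => product B hB y x) (p1 a b)
    simp only [map_sub, LinearMap.sub_apply] at h'
    simp only [LinearMap.sub_apply, Module.End.mul_apply, hL]
    rw [← h']
    rw [← sub_eq_zero] at h ⊢
    rw [← h]
    abel
  have trR : ∀ a, tr (R a) = 0 := fun a => by
    have hn : IsNilpotent (R a) := ⟨2, by
      ext x
      rw [pow_two]
      exact hsq x a⟩
    exact (LinearMap.isNilpotent_trace_of_isNilpotent hn).eq_zero
  have trRR : ∀ a b, tr (R a * R b) = 0 := fun a b => by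
    have h : R a * R b = -(R b * R a) := by
      ext x
      exact hanti x b a
    have h' : tr (R a * R b) = -tr (R a * R b) := by
      conv_lhs => rw [h, map_neg, LinearMap.trace_mul_comm]
    linarith
  have trLR : ∀ a b, tr (L a * R b) = 0 := fun a b => by
    -- In the trace of this identity every term except tr(L a R b) is already known to vanish.
    have h : LieAlgebra.ad ℝ 𝔤 (product B hB a b) + LieAlgebra.ad ℝ 𝔤 a * R b = 0 := by
      ext x
      exact h3 a b x
    have h' := congrArg tr h
    rw [had, had, sub_mul, map_add, map_sub, map_sub, map_zero, trR, trRR] at h'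
    have : tr (L (product B hB a b)) = 0 := trace_eq_zero_of_skew sy hp _ (hLsk _)
    linarith
  let κ : 𝔤 → 𝔤 → ℝ := fun a b => tr (L a * L b)
  have κsub : ∀ a b c, κ (a - b) c = κ a c - κ b c := fun a b c => by
    simp only [κ, L, map_sub, sub_mul]
  have κlie : ∀ a b c, κ ⁅a, b⁆ c = κ ⁅b, c⁆ a := fun a b c => by
    simp only [κ, hflat, sub_mul, map_sub, mul_assoc]
    rw [LinearMap.trace_mul_comm ℝ (L a) (L b * L c), LinearMap.trace_mul_comm ℝ (L b) (L a * L c),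
      mul_assoc, mul_assoc, LinearMap.trace_mul_comm ℝ (L a) (L c * L b), mul_assoc]
  have κsymm : ∀ a b c, κ (product B hB a b) c = κ (product B hB c b) a := fun a b c => by
    have h : ∀ a b, L (product B hB a b) = -(R b * L a) := fun a b => by
      ext x
      exact hanti a b x
    have h' := trLR ⁅a, c⁆ b
    rw [hflat, sub_mul, map_sub, LinearMap.trace_mul_comm ℝ (L a * L c),
      LinearMap.trace_mul_comm ℝ (L c * L a)] at h'
    simp only [κ, h, neg_mul, map_neg, mul_assoc]
    linarith
  -- κ([a, b], c) is invariant under cyclic shifts, while its three shifts sum to zero because κ(ab,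
  -- c) is symmetric in a and c.
  have κzero : ∀ a b c, κ ⁅a, b⁆ c = 0 := fun a b c => by
    have e1 := κlie a b c
    have e2 := κlie b c a
    have f1 := κsub (product B hB a b) (product B hB b a) c
    have f2 := κsub (product B hB b c) (product B hB c b) a
    have f3 := κsub (product B hB c a) (product B hB a c) b
    rw [p1] at f1 f2 f3
    linarith [κsymm a b c, κsymm b c a, κsymm c a b]
  have hLlie : ∀ a b, L ⁅a, b⁆ = 0 := fun a b =>
    eq_zero_of_skew_of_trace_mul_self sy hp _ (hLsk _) (κzero a b _)
  have hcomm : ∀ a b c, product B hB (product B hB a b) c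
      = product B hB (product B hB b a) c := fun a b c => by
    have h := LinearMap.congr_fun (hLlie a b) c
    rw [hL, ← p1, map_sub, LinearMap.sub_apply, LinearMap.zero_apply, sub_eq_zero] at h
    exact h
  -- Alternating the two transpositions three times each returns to the start with sign (-1)³.
  have h6 : product B hB (product B hB u v) w = -product B hB (product B hB u v) w := by
    conv_lhs => rw [hanti u v w, hcomm u w v, hanti w u v, hcomm w v u, hanti v w u, hcomm v u w]
    simp
  rw [eq_neg_iff_add_eq_zero, ← two_smul ℝ] at h6
  exact (smul_eq_zero.1 h6).resolve_left two_ne_zero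

end Structure

/-! ### From a Riemann-Lie algebra to the decomposition -/

section Decomposition

variable {𝔤 : Type*} [LieRing 𝔤] [LieAlgebra ℝ 𝔤] [FiniteDimensional ℝ 𝔤]
  {B : LinearMap.BilinForm ℝ 𝔤}

theorem product_eq_zero_of_mem_productSpan (hB : IsScalarProduct B) (h : IsRiemannLie 𝔤 B)
    {p : 𝔤} (hp : p ∈ productSpan B hB.nondegenerate) (w : 𝔤) :
    product B hB.nondegenerate p w = 0 := by
  induction hp using Submodule.span_induction with
  | mem p hp =>
    obtain ⟨x, y, rfl⟩ := hp
    exact product_product_eq_zero hB.symm hB.pos h.pr3 x y w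
  | zero => simp
  | add p q _ _ h1 h2 => rw [map_add, LinearMap.add_apply, h1, h2, add_zero]
  | smul c p _ h1 => rw [map_smul, LinearMap.smul_apply, h1, smul_zero]

/-- If ad_s is skew, so is R s = L s - ad_s; since (R s)² = 0, it vanishes. Conversely, R s = 0
makes ad_s equal to the skew map L s. -/
theorem orthogonalSubalgebra_eq_Zr (hB : IsScalarProduct B) (h : IsRiemannLie 𝔤 B) :
    (orthogonalSubalgebra B hB).toSubmodule = Zr B hB.nondegenerate := by
  ext s
  rw [LieSubalgebra.mem_toSubmodule, mem_orthogonalSubalgebra_iff, mem_Zr_iff]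
  have p1 := product_sub_product_swap hB.nondegenerate
  have sk := product_skew hB.symm hB.nondegenerate
  constructor
  · intro hs
    refine eq_zero_of_skew_of_sq hB.pos (rightMul B hB.nondegenerate s) (fun x y => ?_)
      (fun x => product_product_self hB.symm hB.pos h.pr3 x s)
    have h' := hs x y
    rw [← p1, ← p1] at h'
    simp only [map_sub, LinearMap.sub_apply] at h'
    change B (product B hB.nondegenerate x s) y + B x (product B hB.nondegenerate y s) = 0
    linarith [sk s x y]
  · intro hs v w
    rw [← p1, ← p1, hs, hs, sub_zero, sub_zero]
    exact sk s v w

theorem orthogonal_orthogonalSubalgebra (hB : IsScalarProduct B) (h : IsRiemannLie 𝔤 B) :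
    B.orthogonal (orthogonalSubalgebra B hB).toSubmodule = productSpan B hB.nondegenerate := by
  rw [orthogonalSubalgebra_eq_Zr hB h, ← orthogonal_productSpan hB.symm,
    orthogonal_orthogonal_of_pos hB.symm.eq hB.pos]

theorem lie_mem_productSpan (hB : IsScalarProduct B) (x y : 𝔤) :
    ⁅x, y⁆ ∈ productSpan B hB.nondegenerate := by
  rw [← product_sub_product_swap hB.nondegenerate]
  exact sub_mem (Submodule.subset_span ⟨x, y, rfl⟩) (Submodule.subset_span ⟨y, x, rfl⟩)

/-- Split y = s + p with s ∈ S and p ∈ 𝔤𝔤: as xs = 0 and px = 0, xy = xp = [x, p]. -/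
theorem productSpan_eq_lie_top (hB : IsScalarProduct B) (h : IsRiemannLie 𝔤 B) :
    productSpan B hB.nondegenerate =
      (⁅(⊤ : LieIdeal ℝ 𝔤), (⊤ : LieIdeal ℝ 𝔤)⁆ : LieIdeal ℝ 𝔤).toSubmodule := by
  rw [LieSubmodule.lieIdeal_oper_eq_linear_span']
  apply le_antisymm
  · refine Submodule.span_le.2 ?_
    rintro _ ⟨x, y, rfl⟩
    obtain ⟨s, p, hs, hp, rfl⟩ := Submodule.codisjoint_iff_exists_add_eq.1
      (isCompl_orthogonal_of_pos hB.symm.eq hB.pos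
        (orthogonalSubalgebra B hB).toSubmodule).codisjoint y
    rw [orthogonalSubalgebra_eq_Zr hB h, mem_Zr_iff] at hs
    rw [orthogonal_orthogonalSubalgebra hB h] at hp
    have h' := product_sub_product_swap hB.nondegenerate x p
    rw [product_eq_zero_of_mem_productSpan hB h hp, sub_zero] at h'
    rw [map_add, hs, zero_add, h']
    exact Submodule.subset_span ⟨x, LieSubmodule.mem_top x, p, LieSubmodule.mem_top p, rfl⟩
  · refine Submodule.span_le.2 ?_
    rintro _ ⟨x, -, y, -, rfl⟩
    exact lie_mem_productSpan hB x y

/-- The span of all products, as an ideal. -/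
def productIdeal (hB : IsScalarProduct B) : LieIdeal ℝ 𝔤 where
  __ := productSpan B hB.nondegenerate
  lie_mem {x y} _ := lie_mem_productSpan hB x y

theorem exists_decomposition (hB : IsScalarProduct B) (h : IsRiemannLie 𝔤 B) :
    (∀ s ∈ orthogonalSubalgebra B hB, ∀ t ∈ orthogonalSubalgebra B hB, ⁅s, t⁆ = 0) ∧
      ∃ U : LieIdeal ℝ 𝔤,
        (∀ u ∈ U, ∀ v ∈ U, ⁅u, v⁆ = 0) ∧
        (∀ s ∈ orthogonalSubalgebra B hB, ∀ u ∈ U, B s u = 0) ∧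
        IsCompl (orthogonalSubalgebra B hB).toSubmodule U.toSubmodule := by
  have p1 := product_sub_product_swap hB.nondegenerate
  have hZ : ∀ s ∈ orthogonalSubalgebra B hB, ∀ v, product B hB.nondegenerate v s = 0 := by
    intro s hs
    rw [← LieSubalgebra.mem_toSubmodule, orthogonalSubalgebra_eq_Zr hB h, mem_Zr_iff] at hs
    exact hs
  have horth := orthogonal_orthogonalSubalgebra hB h
  refine ⟨fun s hs t ht => ?_, productIdeal hB, fun u hu v hv => ?_, fun s hs u hu => ?_, ?_⟩
  · rw [← p1, hZ s hs, hZ t ht, sub_zero]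
  · rw [← p1, product_eq_zero_of_mem_productSpan hB h hu,
      product_eq_zero_of_mem_productSpan hB h hv, sub_zero]
  · have hu' : u ∈ productSpan B hB.nondegenerate := hu
    rw [← horth] at hu'
    exact hu' s hs
  · change IsCompl _ (productSpan B hB.nondegenerate)
    rw [← horth]
    exact isCompl_orthogonal_of_pos hB.symm.eq hB.pos _

end Decomposition

end RiemannLie

theorem mainTheorem3 {𝔤 : Type*} [LieRing 𝔤] [LieAlgebra ℝ 𝔤] [FiniteDimensional ℝ 𝔤]
    (B : LinearMap.BilinForm ℝ 𝔤) (hB : RiemannLie.IsScalarProduct B) :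
    (RiemannLie.IsRiemannLie 𝔤 B ↔
      (∀ s ∈ RiemannLie.orthogonalSubalgebra B hB,
        ∀ t ∈ RiemannLie.orthogonalSubalgebra B hB, ⁅s, t⁆ = 0) ∧
      ∃ U : LieIdeal ℝ 𝔤,
        (∀ u ∈ U, ∀ v ∈ U, ⁅u, v⁆ = 0) ∧
        (∀ s ∈ RiemannLie.orthogonalSubalgebra B hB, ∀ u ∈ U, B s u = 0) ∧
        IsCompl (RiemannLie.orthogonalSubalgebra B hB).toSubmodule U.toSubmodule) ∧
    (RiemannLie.IsRiemannLie 𝔤 B →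
      (RiemannLie.orthogonalSubalgebra B hB).toSubmodule =
        RiemannLie.Zr B hB.nondegenerate ∧
      B.orthogonal (RiemannLie.orthogonalSubalgebra B hB).toSubmodule =
        RiemannLie.productSpan B hB.nondegenerate ∧
      RiemannLie.productSpan B hB.nondegenerate =
        (⁅(⊤ : LieIdeal ℝ 𝔤), (⊤ : LieIdeal ℝ 𝔤)⁆ : LieIdeal ℝ 𝔤).toSubmodule) := by
  refine ⟨⟨RiemannLie.exists_decomposition hB, ?_⟩, fun h =>
    ⟨RiemannLie.orthogonalSubalgebra_eq_Zr hB h, RiemannLie.orthogonal_orthogonalSubalgebra hB h,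
      RiemannLie.productSpan_eq_lie_top hB h⟩⟩
  rintro ⟨hS, U, hU, hSU, hc⟩
  exact RiemannLie.isRiemannLie_of_decomposition hB hS U hU hSU fun x => by
    obtain ⟨s, u, hs, hu, h⟩ := Submodule.codisjoint_iff_exists_add_eq.1 hc.codisjoint x
    exact ⟨s, hs, u, hu, h⟩
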